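/- Let $R$ be an associative ring with unit. An $\mathcal R$-module is a covariant additive functor $\mathbb M$ from left $R$-modules to abelian groups. For a right $R$-module $N$ let $\mathcal N$ be the quasi-coherent $\mathcal R$-module $\mathcal N(S)=N\otimes_R S$, and let $\mathbb M^*$ be the functor $N\mapsto \operatorname{Hom}_{\mathcal R}(\mathbb M,\mathcal N)$ (natural transformations) on right $R$-modules. Let $\langle\text{Qs-ch}\rangle$ be the class of $\mathcal R$-modules $\mathbb M$ that preserve direct limits. Such an $\mathbb M$ is called - an FP module if the natural map $\mathbb M(\prod_{i\in I} S_i)\to\prod_{i\in I}\mathbb M(S_i)$ is an isomorphism for every set $\{S_i\}_{i\in I}$ of left $R$-modules; - an ML module if this natural map is injective for every set $\{S_i\}_{i\in I}$ of left $R$-modules; - an SML module if it is an ML module and, for every FP submodule $\mathbb F\subseteq\mathbb M$, the dual morphism $\mathbb M^*\to\mathbb F^*$ is an epimorphism. A module $M$ is called strict Mittag-Leffler if for every finitely generated submodule $i\colon N\hookrightarrow M$ there exist a finitely presented module $P$ and homomorphisms $f\colon M\to P$, $g\colon P\to M$ such that $g\circ f\circ i=i$. An injective homomorphism $M\to M'$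 of right $R$-modules is called pure if $M\otimes_R S\to M'\otimes_R S$ is injective for every left $R$-module $S$. **Theorem.** Let $M$ be a right $R$-module. Then $M$ is strict Mittag-Leffler if and only if $\mathcal M$ is an SML module. In particular, if $M$ is strict Mittag-Leffler, then there are a set $J$, finitely presented right $R$-modules $P_j$ ($j\in J$) and a pure injective homomorphism $M\to\prod_{j\in J}P_j$; that is, $M$ is isomorphic to a pure submodule of a product of finitely presented modules. -/

import Mathlib

open CategoryTheory CategoryTheory.Limits Opposite
open scoped TensorProduct

universe u

/-! ### The tensor product `M ⊗_R S` over a (not necessarily commutative) ring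

A right `R`-module is a `Module Rᵐᵒᵖ M`, so that `m · r` is `MulOpposite.op r • m`. -/

section Tensor

variable (R : Type u) [Ring R]

/-- The subgroup of `M ⊗_ℤ S` generated by all `(m · r) ⊗ s - m ⊗ (r s)`. -/
def balancedRelations (M S : Type u) [AddCommGroup M] [Module Rᵐᵒᵖ M]
    [AddCommGroup S] [Module R S] : AddSubgroup (M ⊗[ℤ] S) :=
  AddSubgroup.closure
    {x | ∃ (m : M) (r : R) (s : S), x = (MulOpposite.op r • m) ⊗ₜ[ℤ] s - m ⊗ₜ[ℤ] (r • s)}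

/-- `M ⊗_R S`, for a right `R`-module `M` and a left `R`-module `S`: an abelian group. -/
abbrev BalancedTensor (M S : Type u) [AddCommGroup M] [Module Rᵐᵒᵖ M]
    [AddCommGroup S] [Module R S] : Type u :=
  (M ⊗[ℤ] S) ⧸ balancedRelations R M S

variable {M M' M'' : Type u} [AddCommGroup M] [Module Rᵐᵒᵖ M]
  [AddCommGroup M'] [Module Rᵐᵒᵖ M'] [AddCommGroup M''] [Module Rᵐᵒᵖ M'']
  {S S' S'' : Type u} [AddCommGroup S] [Module R S] [AddCommGroup S'] [Module R S']
  [AddCommGroup S''] [Module R S'']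

/-- The pure tensor `m ⊗ s` in `M ⊗_R S`. -/
def BalancedTensor.tmul (m : M) (s : S) : BalancedTensor R M S :=
  QuotientAddGroup.mk (m ⊗ₜ[ℤ] s)

theorem BalancedTensor.tmul_balanced (m : M) (r : R) (s : S) :
    BalancedTensor.tmul R (MulOpposite.op r • m) s = BalancedTensor.tmul R m (r • s) := by
  refine (QuotientAddGroup.eq_iff_sub_mem).2 ?_
  exact AddSubgroup.subset_closure ⟨m, r, s, rfl⟩

/-- The map `f ⊗ g : M ⊗_R S → M' ⊗_R S'`. -/
def BalancedTensor.map (f : M →ₗ[Rᵐᵒᵖ] M') (g : S →ₗ[R] S') :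
    BalancedTensor R M S →+ BalancedTensor R M' S' :=
  QuotientAddGroup.map (balancedRelations R M S) (balancedRelations R M' S')
    (TensorProduct.map f.toAddMonoidHom.toIntLinearMap
      g.toAddMonoidHom.toIntLinearMap).toAddMonoidHom (by
    refine (AddSubgroup.closure_le _).2 ?_
    rintro _ ⟨m, r, s, rfl⟩
    refine AddSubgroup.subset_closure ⟨f m, r, g s, ?_⟩
    simp)

@[simp]
theorem BalancedTensor.map_tmul (f : M →ₗ[Rᵐᵒᵖ] M') (g : S →ₗ[R] S') (m : M) (s : S) :
    BalancedTensor.map R f g (BalancedTensor.tmul R m s) =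
      BalancedTensor.tmul R (f m) (g s) := rfl

/-- Additive maps out of `M ⊗_R S` are determined by their values on pure tensors. -/
theorem BalancedTensor.addHom_ext {A : Type*} [AddCommGroup A]
    {f g : BalancedTensor R M S →+ A}
    (h : ∀ m s, f (BalancedTensor.tmul R m s) = g (BalancedTensor.tmul R m s)) : f = g := by
  refine QuotientAddGroup.addMonoidHom_ext _ ?_
  refine AddMonoidHom.toIntLinearMap_injective ?_
  refine TensorProduct.ext' fun m s => ?_
  exact h m s

theorem BalancedTensor.map_id :
    BalancedTensor.map R (LinearMap.id : M →ₗ[Rᵐᵒᵖ] M) (LinearMap.id : S →ₗ[R] S) =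
      AddMonoidHom.id _ :=
  BalancedTensor.addHom_ext R fun _ _ => rfl

theorem BalancedTensor.map_comp (f : M →ₗ[Rᵐᵒᵖ] M') (f' : M' →ₗ[Rᵐᵒᵖ] M'')
    (g : S →ₗ[R] S') (g' : S' →ₗ[R] S'') :
    BalancedTensor.map R (f'.comp f) (g'.comp g) =
      (BalancedTensor.map R f' g').comp (BalancedTensor.map R f g) :=
  BalancedTensor.addHom_ext R fun _ _ => rfl

theorem BalancedTensor.map_add_right (f : M →ₗ[Rᵐᵒᵖ] M') (g h : S →ₗ[R] S') :
    BalancedTensor.map R f (g + h) = BalancedTensor.map R f g + BalancedTensor.map R f h :=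
  BalancedTensor.addHom_ext R fun m s =>
    congrArg (QuotientAddGroup.mk (s := balancedRelations R M' S'))
      (TensorProduct.tmul_add (R := ℤ) (f m) (g s) (h s))

end Tensor

/-! ### `𝓡`-modules -/

section Functors

variable {R : Type u} [Ring R]

/-- The quasi-coherent `𝓡`-module `S ↦ M ⊗_R S` of a right `R`-module `M`. -/
noncomputable def quasiCoherent (M : ModuleCat.{u} Rᵐᵒᵖ) :
    ModuleCat.{u} R ⥤ AddCommGrpCat.{u} where
  obj S := AddCommGrpCat.of (BalancedTensor R M S)
  map g := AddCommGrpCat.ofHom (BalancedTensor.map R LinearMap.id g.hom)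
  map_id S := by
    ext1
    exact BalancedTensor.map_id R
  map_comp g g' := by
    ext1
    exact BalancedTensor.map_comp R LinearMap.id LinearMap.id g.hom g'.hom

instance (M : ModuleCat.{u} Rᵐᵒᵖ) : (quasiCoherent M).Additive where
  map_add {_ _ g h} := by
    ext1
    exact BalancedTensor.map_add_right R LinearMap.id g.hom h.hom

variable (R) in
/-- `M ↦ 𝓜` as a functor from right `R`-modules to functors on left `R`-modules. -/
noncomputable def quasiCoherentFunctor :
    ModuleCat.{u} Rᵐᵒᵖ ⥤ (ModuleCat.{u} R ⥤ AddCommGrpCat.{u}) where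
  obj M := quasiCoherent M
  map f :=
    { app := fun S => AddCommGrpCat.ofHom (BalancedTensor.map R f.hom LinearMap.id)
      naturality := fun S S' g => by
        ext1
        exact BalancedTensor.addHom_ext R fun _ _ => rfl }
  map_id M := by
    ext S : 2
    ext1
    exact BalancedTensor.map_id R
  map_comp f f' := by
    ext S : 2
    ext1
    exact BalancedTensor.map_comp R f.hom f'.hom LinearMap.id LinearMap.id

/-- The dual `𝕄* : N ↦ Hom_𝓡(𝕄, 𝓝)`, a functor on right `R`-modules. (Groups of natural
transformations live one universe higher.) -/
noncomputable def dualModule (F : ModuleCat.{u} R ⥤ AddCommGrpCat.{u}) :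
    ModuleCat.{u} Rᵐᵒᵖ ⥤ AddCommGrpCat.{u + 1} :=
  quasiCoherentFunctor R ⋙ preadditiveCoyoneda.obj (op F)

/-- The dual morphism `𝕄* ⟶ 𝔽*` of `𝔽 ⟶ 𝕄`, given by precomposition. -/
noncomputable def dualMap {F G : ModuleCat.{u} R ⥤ AddCommGrpCat.{u}} (i : F ⟶ G) :
    dualModule G ⟶ dualModule F :=
  Functor.whiskerLeft (quasiCoherentFunctor R) (preadditiveCoyoneda.map i.op)

/-- Membership in `⟨Qs-ch⟩`: an additive functor from left `R`-modules to abelian groups that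
preserves direct limits (colimits of systems indexed by upward directed sets). -/
structure IsQsCh (F : ModuleCat.{u} R ⥤ AddCommGrpCat.{u}) : Prop where
  additive : F.Additive
  preservesDirectLimits : ∀ (I : Type u) [Preorder I] [IsDirectedOrder I] [Nonempty I],
    PreservesColimitsOfShape I F

/-- The natural map `𝕄(∏ i, S i) → ∏ i, 𝕄(S i)`. -/
def prodComparisonMap (F : ModuleCat.{u} R ⥤ AddCommGrpCat.{u}) {I : Type u}
    (S : I → ModuleCat.{u} R) :
    F.obj (ModuleCat.of R (∀ i, S i)) →+ ∀ i, F.obj (S i) :=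
  AddMonoidHom.pi fun i =>
    (F.map (ModuleCat.ofHom (LinearMap.proj i : (∀ i, S i) →ₗ[R] S i))).hom

/-- FP modules: objects of `⟨Qs-ch⟩` that preserve direct products. -/
structure IsFPFunctor (F : ModuleCat.{u} R ⥤ AddCommGrpCat.{u}) : Prop where
  isQsCh : IsQsCh F
  bijective : ∀ (I : Type u) (S : I → ModuleCat.{u} R),
    Function.Bijective (prodComparisonMap F S)

/-- ML modules. -/
structure IsMLFunctor (F : ModuleCat.{u} R ⥤ AddCommGrpCat.{u}) : Prop where
  isQsCh : IsQsCh F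
  injective : ∀ (I : Type u) (S : I → ModuleCat.{u} R),
    Function.Injective (prodComparisonMap F S)

/-- SML modules: ML modules `𝕄` such that `𝕄* ⟶ 𝔽*` is an epimorphism for every
FP submodule `𝔽 ⊆ 𝕄`. -/
structure IsSMLFunctor (F : ModuleCat.{u} R ⥤ AddCommGrpCat.{u}) : Prop where
  isML : IsMLFunctor F
  epi_dual : ∀ (G : ModuleCat.{u} R ⥤ AddCommGrpCat.{u}) (i : G ⟶ F),
    IsFPFunctor G → Mono i → Epi (dualMap i)

end Functors

/-! ### Modules -/

/-- Strict Mittag-Leffler modules (over `A`; take `A = Rᵐᵒᵖ` for right `R`-modules): for every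
finitely generated submodule `N` there are a finitely presented module `P` and maps
`f : M → P`, `g : P → M` with `g ∘ f` the identity on `N`. -/
def IsStrictMittagLeffler (A : Type u) [Ring A] (M : Type u) [AddCommGroup M] [Module A M] :
    Prop :=
  ∀ N : Submodule A M, N.FG → ∃ (P : ModuleCat.{u} A) (f : M →ₗ[A] P) (g : P →ₗ[A] M),
    Module.FinitePresentation A P ∧ g.comp (f.comp N.subtype) = N.subtype

/-- Pure monomorphisms of right `R`-modules: `f ⊗ S` is injective for every left `R`-module `S`
(in particular, for `S = R`, so is `f`). -/
def IsPureMono (R : Type u) [Ring R] {M M' : Type u} [AddCommGroup M] [Module Rᵐᵒᵖ M]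
    [AddCommGroup M'] [Module Rᵐᵒᵖ M'] (f : M →ₗ[Rᵐᵒᵖ] M') : Prop :=
  ∀ S : ModuleCat.{u} R,
    Function.Injective (BalancedTensor.map R f (LinearMap.id : S →ₗ[R] S))

/-! Forward direction. An element of `M ⊗ S` involves only finitely many elements of `M`, so for a
strict Mittag-Leffler `M` it is fixed by some `g ∘ f` through a finitely presented `P`
(`exists_fg_map_map_eq`). Injectivity of the product comparison thus descends from `P` to `M`. An FP
functor is generated by a single `x ∈ 𝔽(A)` (`IsFPFunctor.exists_generator`), so a morphism `w : 𝔽 ⟶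
𝓝` is determined by `w(x)`. If `𝔽 ⊆ 𝓜` and `P` is chosen for `x ∈ M ⊗ A`, then `w(x)` dies wherever
`f(x)` does, and `exists_map_eq_of_forall_map_eq_zero` gives `φ : P → N` with `φ(f(x)) = w(x)`; thus
`φ ∘ f` extends `w`.

Backward direction. Let `m₁, …, mₙ` generate `N`. The ML property makes the image of `𝓡ⁿ → 𝓜` an FP
submodule, and makes all relations among the `mᵢ` specializations of a single one. That one relation
already holds for lifts `pᵢ` of the `mᵢ` to a finitely presented `g : P → M`, so `mᵢ ↦ pᵢ` defines a
morphism from the image to `𝓟`. The SML property extends it to `𝓜`, and its value at `R` is a map `f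
: M → P` with `g (f mᵢ) = mᵢ`.

The pure embedding is the product of the maps `f` over all finitely generated submodules. -/

/-! ### Tensor products over a noncommutative ring -/

section TensorBasics

variable (R : Type u) [Ring R]
variable {M M' : Type u} [AddCommGroup M] [Module Rᵐᵒᵖ M]
  [AddCommGroup M'] [Module Rᵐᵒᵖ M']
  {S S' : Type u} [AddCommGroup S] [Module R S] [AddCommGroup S'] [Module R S']
  {A : Type*} [AddCommGroup A]

namespace BalancedTensor

variable (M S) in
/-- The biadditive map `(m, s) ↦ m ⊗ s`. -/
def tmulHom : M →+ S →+ BalancedTensor R M S :=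
  AddMonoidHom.mk' (fun m => AddMonoidHom.mk' (fun s => tmul R m s) fun s t =>
      congrArg (QuotientAddGroup.mk (s := balancedRelations R M S)) (TensorProduct.tmul_add m s t))
    fun m m' => AddMonoidHom.ext fun s =>
      congrArg (QuotientAddGroup.mk (s := balancedRelations R M S)) (TensorProduct.add_tmul m m' s)

theorem tmul_add (m : M) (s t : S) : tmul R m (s + t) = tmul R m s + tmul R m t :=
  map_add (tmulHom R M S m) s t

theorem add_tmul (m m' : M) (s : S) : tmul R (m + m') s = tmul R m s + tmul R m' s :=
  congrArg (· s) (map_add (tmulHom R M S) m m')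

theorem tmul_zero (m : M) : tmul R m (0 : S) = 0 := map_zero (tmulHom R M S m)

theorem zero_tmul (s : S) : tmul R (0 : M) s = 0 := congrArg (· s) (map_zero (tmulHom R M S))

theorem tmul_sub (m : M) (s t : S) : tmul R m (s - t) = tmul R m s - tmul R m t :=
  map_sub (tmulHom R M S m) s t

theorem sub_tmul (m m' : M) (s : S) : tmul R (m - m') s = tmul R m s - tmul R m' s :=
  congrArg (· s) (map_sub (tmulHom R M S) m m')

theorem tmul_sum {ι : Type*} (t : Finset ι) (m : M) (s : ι → S) :
    tmul R m (∑ i ∈ t, s i) = ∑ i ∈ t, tmul R m (s i) :=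
  map_sum (tmulHom R M S m) s t

theorem sum_tmul {ι : Type*} (t : Finset ι) (m : ι → M) (s : S) :
    tmul R (∑ i ∈ t, m i) s = ∑ i ∈ t, tmul R (m i) s :=
  map_sum ((tmulHom R M S).flip s) m t

variable {R} in
/-- Balanced biadditive maps factor through `M ⊗_R S`. -/
def lift (f : M →+ S →+ A)
    (hf : ∀ (m : M) (r : R) (s : S), f (MulOpposite.op r • m) s = f m (r • s)) :
    BalancedTensor R M S →+ A :=
  QuotientAddGroup.lift _ (TensorProduct.liftAddHom (R := ℤ) f fun n m s => by simp) (by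
    refine (AddSubgroup.closure_le _).2 ?_
    rintro _ ⟨m, r, s, rfl⟩
    simp [AddMonoidHom.mem_ker, hf])

/-- The map `s ↦ ∑ i, m i ⊗ s i`. -/
def sumTmul {ι : Type*} [Fintype ι] (m : ι → M) (S : Type u) [AddCommGroup S] [Module R S] :
    (ι → S) →+ BalancedTensor R M S :=
  AddMonoidHom.mk' (fun s => ∑ i, tmul R (m i) (s i)) fun s t => by
    simp [tmul_add, Finset.sum_add_distrib]

theorem sumTmul_apply {ι : Type*} [Fintype ι] (m : ι → M) (s : ι → S) :
    sumTmul R m S s = ∑ i, tmul R (m i) (s i) := rfl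

theorem map_sumTmul {ι : Type*} [Fintype ι] (f : M →ₗ[Rᵐᵒᵖ] M') (g : S →ₗ[R] S')
    (m : ι → M) (s : ι → S) :
    map R f g (sumTmul R m S s) = sumTmul R (fun i => f (m i)) S' (fun i => g (s i)) := by
  simp [sumTmul_apply]

theorem exists_eq_sumTmul (x : BalancedTensor R M S) :
    ∃ (n : ℕ) (m : Fin n → M) (s : Fin n → S), x = sumTmul R m S s := by
  obtain ⟨x, rfl⟩ := QuotientAddGroup.mk_surjective x
  induction x using TensorProduct.induction_on with
  | zero => exact ⟨0, Fin.elim0, Fin.elim0, by simp [sumTmul_apply]⟩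
  | tmul m s => exact ⟨1, fun _ => m, fun _ => s, by simp [sumTmul_apply, tmul]⟩
  | add x y hx hy =>
    obtain ⟨n, m, s, h⟩ := hx
    obtain ⟨n', m', s', h'⟩ := hy
    refine ⟨n + n', Fin.append m m', Fin.append s s', ?_⟩
    rw [QuotientAddGroup.mk_add, h, h']
    simp [sumTmul_apply, Fin.sum_univ_add]

/-- Right exactness of the tensor product in both variables. -/
theorem mem_closure_of_map_eq_zero (f : M →ₗ[Rᵐᵒᵖ] M') (g : S →ₗ[R] S')
    (hf : Function.Surjective f) (hg : Function.Surjective g) (x : BalancedTensor R M S)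
    (hx : map R f g x = 0) :
    x ∈ AddSubgroup.closure {y | ∃ m s, (f m = 0 ∨ g s = 0) ∧ y = tmul R m s} := by
  set C := AddSubgroup.closure
    {y : BalancedTensor R M S | ∃ m s, (f m = 0 ∨ g s = 0) ∧ y = tmul R m s} with hC
  -- Modulo `C`, the class of `m ⊗ s` depends only on `f m` and `g s`. Set-theoretic sections of `f`
  -- and `g` therefore give a well-defined biadditive balanced map on `M' × S'`.
  have key : ∀ (m m' : M) (s s' : S), f m = f m' → g s = g s' →
      (QuotientAddGroup.mk (tmul R m s) : BalancedTensor R M S ⧸ C) =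
        QuotientAddGroup.mk (tmul R m' s') := by
    intro m m' s s' h h'
    rw [QuotientAddGroup.eq_iff_sub_mem]
    have e : tmul R m s - tmul R m' s' = tmul R (m - m') s + tmul R m' (s - s') := by
      rw [sub_tmul, tmul_sub]; abel
    rw [e]
    exact add_mem (AddSubgroup.subset_closure ⟨_, _, Or.inl (by simp [h]), rfl⟩)
      (AddSubgroup.subset_closure ⟨_, _, Or.inr (by simp [h']), rfl⟩)
  let a := Function.surjInv hf
  let b := Function.surjInv hg
  have ha : ∀ m, f (a m) = m := Function.surjInv_eq hf
  have hb : ∀ s, g (b s) = s := Function.surjInv_eq hg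
  let φ : M' →+ S' →+ BalancedTensor R M S ⧸ C :=
    AddMonoidHom.mk' (fun m => AddMonoidHom.mk'
      (fun s => QuotientAddGroup.mk (tmul R (a m) (b s))) (fun s t => by
        rw [← QuotientAddGroup.mk_add, ← tmul_add]
        exact key _ _ _ _ rfl (by simp [hb])))
      (fun m m' => AddMonoidHom.ext fun s => by
        refine (key (a (m + m')) (a m + a m') (b s) (b s) (by simp [ha]) rfl).trans ?_
        exact congrArg (QuotientAddGroup.mk (s := C)) (add_tmul R (a m) (a m') (b s)))
  let ψ : BalancedTensor R M' S' →+ BalancedTensor R M S ⧸ C := lift φ fun m r s => by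
    refine (key (a (MulOpposite.op r • m)) (MulOpposite.op r • a m) (b s) (b s)
      (by simp [ha]) rfl).trans ?_
    rw [tmul_balanced]
    exact key _ _ _ _ rfl (by simp [hb])
  -- `ψ` undoes `f ⊗ g` modulo `C`, so the kernel of `f ⊗ g` lies in `C`.
  have h : ψ.comp (map R f g) = QuotientAddGroup.mk' C := addHom_ext R fun m s =>
    key _ _ _ _ (ha _) (hb _)
  rw [← QuotientAddGroup.eq_zero_iff]
  have := DFunLike.congr_fun h x
  simpa [hx] using this.symm

end BalancedTensor

end TensorBasics

/-! ### Finite presentations and vanishing in tensor products -/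

section Presentation

variable (R : Type u) [Ring R]

open BalancedTensor

/-- A finite presentation of a right module `P`, with generators `p` and relations `ρ`,
describes the maps out of `P` and the tensor products `P ⊗_R S`. -/
theorem Module.FinitePresentation.exists_generators_relations (P : Type u) [AddCommGroup P]
    [Module Rᵐᵒᵖ P] [Module.FinitePresentation Rᵐᵒᵖ P] :
    ∃ (n r : ℕ) (p : Fin n → P) (ρ : Fin r → Fin n → R),
      (∀ k, ∑ j, MulOpposite.op (ρ k j) • p j = 0) ∧
      (∀ (N : Type u) [AddCommGroup N] [Module Rᵐᵒᵖ N] (v : Fin n → N),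
        (∀ k, ∑ j, MulOpposite.op (ρ k j) • v j = 0) →
          ∃ φ : P →ₗ[Rᵐᵒᵖ] N, ∀ j, φ (p j) = v j) ∧
      (∀ (S : Type u) [AddCommGroup S] [Module R S],
        Function.Surjective (sumTmul R p S)) ∧
      ∀ (S : Type u) [AddCommGroup S] [Module R S] (s : Fin n → S),
        sumTmul R p S s = 0 → ∃ t : Fin r → S, ∀ j, s j = ∑ k, ρ k j • t k := by
  obtain ⟨n, r, f, g, hf, hfg⟩ := Module.FinitePresentation.exists_fin' Rᵐᵒᵖ P
  have hfsum : ∀ v : Fin n → Rᵐᵒᵖ, f v = ∑ j, v j • f (Pi.single j 1) := fun v => by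
    conv_lhs => rw [← (Pi.basisFun Rᵐᵒᵖ (Fin n)).sum_repr v]
    simp
  have hgsum : ∀ v : Fin r → Rᵐᵒᵖ, g v = ∑ k, v k • g (Pi.single k 1) := fun v => by
    conv_lhs => rw [← (Pi.basisFun Rᵐᵒᵖ (Fin r)).sum_repr v]
    simp
  refine ⟨n, r, fun j => f (Pi.single j 1),
    fun k j => MulOpposite.unop (g (Pi.single k 1) j), ?_, ?_, ?_, ?_⟩
  · intro k
    simp only [MulOpposite.op_unop]
    rw [← hfsum]
    exact hfg.apply_apply_eq_zero _
  · intro N _ _ v hv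
    simp only [MulOpposite.op_unop] at hv
    have hker : LinearMap.ker f ≤ LinearMap.ker (Fintype.linearCombination Rᵐᵒᵖ v) := by
      intro x hx
      obtain ⟨y, rfl⟩ := (hfg x).1 hx
      rw [LinearMap.mem_ker, hgsum, map_sum]
      refine Finset.sum_eq_zero fun k _ => ?_
      rw [map_smul, Fintype.linearCombination_apply, hv, smul_zero]
    refine ⟨(LinearMap.ker f).liftQ _ hker ∘ₗ
      (f.quotKerEquivOfSurjective hf).symm.toLinearMap, fun j => ?_⟩
    have : (f.quotKerEquivOfSurjective hf).symm (f (Pi.single j 1)) =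
        (LinearMap.ker f).mkQ (Pi.single j 1) := by
      rw [LinearEquiv.symm_apply_eq]; rfl
    simp [this]
  · intro S _ _ x
    obtain ⟨m, q, s, rfl⟩ := exists_eq_sumTmul R x
    rw [sumTmul_apply, ← AddMonoidHom.mem_range]
    refine sum_mem fun i _ => ?_
    obtain ⟨v, hv⟩ := hf (q i)
    refine ⟨fun j => MulOpposite.unop (v j) • s i, ?_⟩
    rw [← hv, hfsum v, sum_tmul, sumTmul_apply]
    refine Finset.sum_congr rfl fun j _ => ?_
    rw [← tmul_balanced, MulOpposite.op_unop]
  · intro S _ _ s hs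
    have h0 : BalancedTensor.map R f (LinearMap.id : S →ₗ[R] S)
        (sumTmul R (fun j => (Pi.single j 1 : Fin n → Rᵐᵒᵖ)) S s) = 0 := by
      rw [map_sumTmul]; exact hs
    have h1 := mem_closure_of_map_eq_zero R f LinearMap.id hf Function.surjective_id _ h0
    -- `ev` identifies `Rⁿ ⊗ S` with `Sⁿ`; by right exactness the kernel of `Rⁿ ⊗ S → P ⊗ S` is
    -- carried into the image `W.range` of the relations.
    let ev : BalancedTensor R (Fin n → Rᵐᵒᵖ) S →+ (Fin n → S) :=
      lift (AddMonoidHom.mk' (fun v => AddMonoidHom.mk'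
        (fun t j => MulOpposite.unop (v j) • t) (fun s t => by ext; simp))
        (fun v w => by ext; simp [add_smul])) (fun v a t => by ext; simp [mul_smul])
    have hev : ∀ v t, ev (tmul R v t) = fun j => MulOpposite.unop (v j) • t := fun _ _ => rfl
    let W : (Fin r → S) →+ (Fin n → S) :=
      AddMonoidHom.mk' (fun t j => ∑ k, MulOpposite.unop (g (Pi.single k 1) j) • t k)
        (fun s t => by ext; simp [Finset.sum_add_distrib])
    have h2 : sumTmul R (fun j => (Pi.single j 1 : Fin n → Rᵐᵒᵖ)) S s ∈ W.range.comap ev := by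
      refine (AddSubgroup.closure_le _).2 ?_ h1
      rintro _ ⟨v, t, hvt, rfl⟩
      rcases hvt with hv | ht
      · obtain ⟨y, rfl⟩ := (hfg v).1 hv
        refine ⟨fun k => MulOpposite.unop (y k) • t, ?_⟩
        rw [hev, hgsum]
        ext j
        simp [W, Finset.sum_smul, mul_smul]
      · rw [LinearMap.id_apply] at ht
        rw [ht, tmul_zero]
        exact zero_mem _
    obtain ⟨t, ht⟩ := h2
    refine ⟨t, fun j => ?_⟩
    have := congrFun ht j
    rw [sumTmul_apply, map_sum] at this
    simp only [hev, Finset.sum_apply] at this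
    rw [Finset.sum_eq_single j (fun i _ hi => by simp [Pi.single_eq_of_ne hi.symm]) (by simp)]
      at this
    simpa [W] using this.symm

/-- Over a finitely presented right module, `P ⊗ ∏ S i → ∏ P ⊗ S i` is injective. -/
theorem BalancedTensor.eq_zero_of_map_proj_eq_zero (P : Type u) [AddCommGroup P]
    [Module Rᵐᵒᵖ P] [Module.FinitePresentation Rᵐᵒᵖ P] {I : Type u} (S : I → Type u)
    [∀ i, AddCommGroup (S i)] [∀ i, Module R (S i)] (x : BalancedTensor R P (∀ i, S i))
    (hx : ∀ i, BalancedTensor.map R LinearMap.id (LinearMap.proj i : (∀ i, S i) →ₗ[R] S i) x = 0) :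
    x = 0 := by
  obtain ⟨n, r, p, ρ, hρ, -, hsurj, hvan⟩ :=
    Module.FinitePresentation.exists_generators_relations R P
  obtain ⟨s, rfl⟩ := hsurj _ x
  have : ∀ i, ∃ t : Fin r → S i, ∀ j, s j i = ∑ k, ρ k j • t k := fun i => by
    refine hvan (S i) (fun j => s j i) ?_
    have := hx i
    rwa [map_sumTmul] at this
  choose t ht using this
  -- The number `r` of relations does not depend on `i`, so the witnesses in the factors assemble
  -- into witnesses in the product.
  have hs : ∀ j, s j = ∑ k, ρ k j • fun i => t i k := fun j => by
    ext i; simp [ht]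
  rw [sumTmul_apply]
  simp_rw [hs, tmul_sum, ← tmul_balanced]
  rw [Finset.sum_comm]
  refine Finset.sum_eq_zero fun k _ => ?_
  rw [← sum_tmul, hρ, zero_tmul]

/-- If `c` vanishes wherever `b` does, then `c` is the image of `b` under a map out of the
finitely presented module `P`. -/
theorem BalancedTensor.exists_map_eq_of_forall_map_eq_zero (P N A : Type u) [AddCommGroup P]
    [Module Rᵐᵒᵖ P] [Module.FinitePresentation Rᵐᵒᵖ P] [AddCommGroup N] [Module Rᵐᵒᵖ N]
    [AddCommGroup A] [Module R A] (b : BalancedTensor R P A) (c : BalancedTensor R N A)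
    (hbc : ∀ (S : Type u) [AddCommGroup S] [Module R S] (h : A →ₗ[R] S),
      BalancedTensor.map R LinearMap.id h b = 0 → BalancedTensor.map R LinearMap.id h c = 0) :
    ∃ φ : P →ₗ[Rᵐᵒᵖ] N, BalancedTensor.map R φ LinearMap.id b = c := by
  obtain ⟨n, r, p, ρ, hρ, hlift, hsurj, -⟩ :=
    Module.FinitePresentation.exists_generators_relations R P
  obtain ⟨b, rfl⟩ := hsurj _ b
  -- `(A × Rʳ) / L` is the universal module under `A` in which `b` vanishes: it adjoins elements `e
  -- k` subject to `b j = ∑ k, ρ k j • e k`.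
  let w : Fin n → A × (Fin r → R) := fun j => (b j, fun k => -ρ k j)
  let L : Submodule R (A × (Fin r → R)) := Submodule.span R (Set.range w)
  have hb : BalancedTensor.map R LinearMap.id (L.mkQ ∘ₗ LinearMap.inl R A (Fin r → R))
      (sumTmul R p A b) = 0 := by
    have e : ∀ j, (L.mkQ ∘ₗ LinearMap.inl R A (Fin r → R)) (b j) =
        ∑ k, ρ k j • L.mkQ (0, Pi.single k 1) := fun j => by
      simp_rw [← map_smul, ← map_sum, LinearMap.comp_apply]
      rw [← sub_eq_zero, ← map_sub, Submodule.mkQ_apply, Submodule.Quotient.mk_eq_zero]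
      refine Submodule.subset_span ⟨j, ?_⟩
      ext k
      · simp [w, Prod.fst_sum]
      · simp [w, Prod.snd_sum, Finset.sum_apply, Pi.single_apply]
    rw [map_sumTmul, sumTmul_apply]
    simp_rw [e, tmul_sum, ← tmul_balanced]
    rw [Finset.sum_comm]
    refine Finset.sum_eq_zero fun k _ => ?_
    rw [← sum_tmul]
    simp [hρ, zero_tmul]
  have hc := hbc _ _ hb
  have hc' : BalancedTensor.map R (LinearMap.id : N →ₗ[Rᵐᵒᵖ] N) L.mkQ
      (BalancedTensor.map R LinearMap.id (LinearMap.inl R A (Fin r → R)) c) = 0 := by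
    rw [← hc, ← AddMonoidHom.comp_apply, ← map_comp]; rfl
  have h1 := mem_closure_of_map_eq_zero R _ _ Function.surjective_id L.mkQ_surjective _ hc'
  let T : (Fin n → N) →+ BalancedTensor R N (A × (Fin r → R)) :=
    AddMonoidHom.mk' (fun v => ∑ j, tmul R (v j) (w j)) fun v v' => by
      simp [add_tmul, Finset.sum_add_distrib]
  have h2 : BalancedTensor.map R LinearMap.id (LinearMap.inl R A (Fin r → R)) c ∈ T.range := by
    refine (AddSubgroup.closure_le _).2 ?_ h1
    rintro _ ⟨m, l, hml, rfl⟩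
    rcases hml with hm | hl
    · rw [LinearMap.id_apply] at hm
      rw [hm, zero_tmul]
      exact zero_mem _
    · rw [Submodule.mkQ_apply, Submodule.Quotient.mk_eq_zero] at hl
      obtain ⟨a, rfl⟩ := (Submodule.mem_span_range_iff_exists_fun R).1 hl
      refine ⟨fun j => MulOpposite.op (a j) • m, ?_⟩
      simp [T, tmul_sum, tmul_balanced]
  -- In `∑ v j ⊗ w j = c ⊗ (1, 0)`, written loosely, the `A`-coordinate gives `c = ∑ v j ⊗ b j`, and
  -- the `Rʳ`-coordinates say that `v` satisfies the relations of `P`. Hence `p j ↦ v j` is the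
  -- required map.
  obtain ⟨v, hv⟩ := h2
  have hv' : ∑ j, tmul R (v j) (w j) =
    BalancedTensor.map R LinearMap.id (LinearMap.inl R A (Fin r → R)) c := hv
  have hcv : c = ∑ j, tmul R (v j) (b j) := by
    have := congrArg (BalancedTensor.map R LinearMap.id (LinearMap.fst R A (Fin r → R))) hv'
    rw [← AddMonoidHom.comp_apply, ← map_comp, LinearMap.fst_comp_inl, LinearMap.id_comp, map_id,
      AddMonoidHom.id_apply, map_sum] at this
    exact this.symm
  let act : BalancedTensor R N R →+ N :=
    lift (AddMonoidHom.mk' (fun m => AddMonoidHom.mk' (fun a : R => MulOpposite.op a • m)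
      (fun a b => by simp [add_smul])) (fun m m' => by ext; simp))
      (fun m a b => by simp [mul_smul])
  have hact : ∀ m a, act (tmul R m a) = MulOpposite.op a • m := fun _ _ => rfl
  obtain ⟨φ, hφ⟩ := hlift N v fun k => by
    have := congrArg (fun z => act (BalancedTensor.map R LinearMap.id
      (LinearMap.proj k ∘ₗ LinearMap.snd R A (Fin r → R)) z)) hv'
    rw [← AddMonoidHom.comp_apply (BalancedTensor.map R _ _), ← map_comp, LinearMap.comp_assoc,
      LinearMap.snd_comp_inl, LinearMap.comp_zero] at this
    have z : BalancedTensor.map R (LinearMap.id ∘ₗ LinearMap.id : N →ₗ[Rᵐᵒᵖ] N)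
        (0 : A →ₗ[R] R) = 0 :=
      addHom_ext R fun m s => by simp [tmul_zero]
    rw [z] at this
    simpa [hact, w, map_sum] using this
  refine ⟨φ, ?_⟩
  rw [map_sumTmul, hcv, sumTmul_apply]
  simp [hφ]

end Presentation

/-! ### Lifting a relation to a finitely presented module -/

section Vanishing

variable (R : Type u) [Ring R]

open BalancedTensor

/-- A relation in `M ⊗_R S` already holds in `P ⊗_R S` for a finitely presented `P → M`. -/
theorem BalancedTensor.exists_finitePresentation_of_sumTmul_eq_zero {M S : Type u}
    [AddCommGroup M] [Module Rᵐᵒᵖ M] [AddCommGroup S] [Module R S] {n : ℕ} (m : Fin n → M)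
    (s : Fin n → S) (h : sumTmul R m S s = 0) :
    ∃ (P : ModuleCat.{u} Rᵐᵒᵖ) (p : Fin n → P) (g : P →ₗ[Rᵐᵒᵖ] M),
      Module.FinitePresentation Rᵐᵒᵖ P ∧ (∀ i, g (p i) = m i) ∧ sumTmul R p S s = 0 := by
  classical
  let f : (M →₀ Rᵐᵒᵖ) →ₗ[Rᵐᵒᵖ] M := Finsupp.linearCombination Rᵐᵒᵖ id
  have hf : Function.Surjective f := Finsupp.linearCombination_id_surjective _ _
  let e : Fin n → (M →₀ Rᵐᵒᵖ) := fun i => Finsupp.single (m i) 1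
  have hfe : ∀ i, f (e i) = m i := fun i => by simp [f, e]
  have h0 : BalancedTensor.map R f (LinearMap.id : S →ₗ[R] S) (sumTmul R e S s) = 0 := by
    rw [map_sumTmul]; simpa [hfe] using h
  have h1 := mem_closure_of_map_eq_zero R f LinearMap.id hf Function.surjective_id _ h0
  have h2 : ∃ (r : ℕ) (l : Fin r → (M →₀ Rᵐᵒᵖ)) (t : Fin r → S),
      (∀ k, f (l k) = 0) ∧ sumTmul R e S s = sumTmul R l S t := by
    generalize sumTmul R e S s = x at h1
    induction h1 using AddSubgroup.closure_induction with
    | mem x hx =>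
      obtain ⟨v, t, hvt, rfl⟩ := hx
      rcases hvt with hv | ht
      · exact ⟨1, fun _ => v, fun _ => t, fun _ => hv, by simp [sumTmul_apply]⟩
      · rw [LinearMap.id_apply] at ht
        exact ⟨0, Fin.elim0, Fin.elim0, fun k => k.elim0, by simp [sumTmul_apply, ht, tmul_zero]⟩
    | zero => exact ⟨0, Fin.elim0, Fin.elim0, fun k => k.elim0, by simp [sumTmul_apply]⟩
    | add x y _ _ hx hy =>
      obtain ⟨r, l, t, hl, rfl⟩ := hx
      obtain ⟨r', l', t', hl', rfl⟩ := hy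
      refine ⟨r + r', Fin.append l l', Fin.append t t', fun k => ?_, ?_⟩
      · refine Fin.addCases (fun k => ?_) (fun k => ?_) k <;> simp [hl, hl']
      · simp [sumTmul_apply, Fin.sum_univ_add]
    | neg x _ hx =>
      obtain ⟨r, l, t, hl, rfl⟩ := hx
      exact ⟨r, l, -t, hl, (map_neg _ _).symm⟩
  obtain ⟨r, l, t, hl, hlt⟩ := h2
  -- Only finitely many basis elements of the free module occur in the `m i` and in the relations `l
  -- k`; `P` is the free module on these modulo the `l k`.
  let T : Finset M := Finset.univ.image m ∪ Finset.univ.biUnion fun k => (l k).support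
  let res : (M →₀ Rᵐᵒᵖ) →ₗ[Rᵐᵒᵖ] (T →₀ Rᵐᵒᵖ) :=
    Finsupp.lcomapDomain Subtype.val Subtype.val_injective
  let ext : (T →₀ Rᵐᵒᵖ) →ₗ[Rᵐᵒᵖ] (M →₀ Rᵐᵒᵖ) := Finsupp.lmapDomain Rᵐᵒᵖ Rᵐᵒᵖ Subtype.val
  have hre : ∀ v : M →₀ Rᵐᵒᵖ, v.support ⊆ T → ext (res v) = v := fun v hv =>
    Finsupp.mapDomain_comapDomain _ Subtype.val_injective _ (by simpa using hv)
  let K : Submodule Rᵐᵒᵖ (T →₀ Rᵐᵒᵖ) := Submodule.span _ (Set.range fun k => res (l k))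
  have hK : K ≤ LinearMap.ker (f ∘ₗ ext) := by
    rw [Submodule.span_le]
    rintro _ ⟨k, rfl⟩
    have : (l k).support ⊆ T := fun x hx => Finset.mem_union_right _
      (Finset.mem_biUnion.2 ⟨k, Finset.mem_univ _, hx⟩)
    simp [hre _ this, hl]
  refine ⟨ModuleCat.of Rᵐᵒᵖ ((T →₀ Rᵐᵒᵖ) ⧸ K), fun i => K.mkQ (res (e i)),
    K.liftQ (f ∘ₗ ext) hK, ?_, fun i => ?_, ?_⟩
  · refine Module.finitePresentation_of_free_of_surjective K.mkQ K.mkQ_surjective ?_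
    rw [Submodule.ker_mkQ]
    exact Submodule.fg_span (Set.finite_range _)
  · have : (e i).support ⊆ T := (Finsupp.support_single_subset).trans (by simp [T])
    simp [hre _ this, hfe]
  · have := congrArg (BalancedTensor.map R (K.mkQ ∘ₗ res) LinearMap.id) hlt
    rw [map_sumTmul, map_sumTmul] at this
    refine this.trans (Eq.trans (sumTmul_apply R _ _) ?_)
    refine Finset.sum_eq_zero fun k _ => ?_
    have hk : (K.mkQ ∘ₗ res) (l k) = 0 := by
      rw [LinearMap.comp_apply, Submodule.mkQ_apply, Submodule.Quotient.mk_eq_zero]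
      exact Submodule.subset_span ⟨k, rfl⟩
    rw [hk, zero_tmul]

end Vanishing

/-! ### Direct limits and generators of functors -/

section Colimits

variable {R : Type u} [Ring R]

open BalancedTensor

/-- The left module of additive maps out of a right module. -/
@[reducible] def rightModuleHomModule (M A : Type u) [AddCommGroup M] [Module Rᵐᵒᵖ M]
    [AddCommGroup A] : Module R (M →+ A) where
  smul r f := f.comp (DistribSMul.toAddMonoidHom M (MulOpposite.op r))
  one_smul f := by ext m; exact congrArg f (one_smul _ m)
  mul_smul a b f := by ext m; exact congrArg f (mul_smul (MulOpposite.op b) (MulOpposite.op a) m)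
  smul_zero r := rfl
  smul_add r f g := rfl
  add_smul a b f := by
    ext m
    exact (congrArg f (add_smul (MulOpposite.op a) (MulOpposite.op b) m)).trans (map_add f _ _)
  zero_smul f := by ext m; exact (congrArg f (zero_smul Rᵐᵒᵖ m)).trans (map_zero f)

/-- The value at `A` of the right adjoint of `S ↦ M ⊗_R S`. -/
def homObj (M : ModuleCat.{u} Rᵐᵒᵖ) (A : AddCommGrpCat.{u}) : ModuleCat.{u} R :=
  letI := rightModuleHomModule (R := R) M A
  ModuleCat.of R (M →+ A)

/-- Additive maps `M ⊗_R S → A` are linear maps `S → Hom(M, A)`. -/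
noncomputable def tensorHomEquiv (M : ModuleCat.{u} Rᵐᵒᵖ) (S : ModuleCat.{u} R) (A : AddCommGrpCat.{u}) :
    ((quasiCoherent M).obj S ⟶ A) ≃ (S ⟶ homObj M A) :=
  letI := rightModuleHomModule (R := R) M A
  { toFun := fun f => ModuleCat.ofHom
      { toFun := fun s => f.hom.comp ((tmulHom R M S).flip s)
        map_add' := fun s t => by
          ext m
          exact (congrArg f.hom (tmul_add R m s t)).trans (map_add f.hom _ _)
        map_smul' := fun r s => by
          ext m
          exact congrArg f.hom (tmul_balanced R m r s).symm }
    invFun := fun g => AddCommGrpCat.ofHom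
      (lift (AddMonoidHom.flip (show S →+ (M →+ A) from g.hom.toAddMonoidHom)) fun m r s =>
        (DFunLike.congr_fun (show (show M →+ A from g.hom (r • s)) = _ from g.hom.map_smul r s)
          m).symm)
    left_inv := fun f => by
      ext1
      exact addHom_ext R fun _ _ => rfl
    right_inv := fun g => rfl }

instance (M : ModuleCat.{u} Rᵐᵒᵖ) : (quasiCoherent M).IsLeftAdjoint :=
  ⟨_, ⟨Adjunction.adjunctionOfEquivRight (F := quasiCoherent M) (G_obj := homObj M)
    (e := fun S A => tensorHomEquiv M S A) (he := fun _ _ _ _ _ => rfl)⟩⟩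

/-- Tensoring with `M` is left adjoint to `A ↦ Hom(M, A)`, so it preserves all colimits. -/
theorem isQsCh_quasiCoherent (M : ModuleCat.{u} Rᵐᵒᵖ) : IsQsCh (quasiCoherent M) where
  additive := inferInstance
  preservesDirectLimits _ _ _ _ :=
    ((Adjunction.ofIsLeftAdjoint (quasiCoherent M)).leftAdjoint_preservesColimits).1

/-- Recognizing directed colimits of abelian groups. -/
noncomputable def AddCommGrpCat.isColimitOf {I : Type u} [SmallCategory I] [IsFiltered I]
    {K : I ⥤ AddCommGrpCat.{u}} (c : Cocone K)
    (hsurj : ∀ x : c.pt, ∃ i, ∃ y : K.obj i, (c.ι.app i).hom y = x)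
    (hinj : ∀ i j (x : K.obj i) (y : K.obj j), (c.ι.app i).hom x = (c.ι.app j).hom y →
      ∃ (k : I) (a : i ⟶ k) (b : j ⟶ k), (K.map a).hom x = (K.map b).hom y) : IsColimit c :=
  haveI : ReflectsColimitsOfShape I (forget AddCommGrpCat.{u}) :=
    reflectsColimitsOfShape_of_reflectsIsomorphisms
  isColimitOfReflects (forget AddCommGrpCat.{u}) <|
    Types.FilteredColimit.isColimitOf _ _
      (fun x => by obtain ⟨i, y, h⟩ := hsurj x; exact ⟨i, y, h.symm⟩) hinj

/-- Recognizing directed colimits of modules. -/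
noncomputable def ModuleCat.isColimitOf {I : Type u} [SmallCategory I] [IsFiltered I]
    {K : I ⥤ ModuleCat.{u} R} (c : Cocone K)
    (hsurj : ∀ x : c.pt, ∃ i, ∃ y : K.obj i, (c.ι.app i).hom y = x)
    (hinj : ∀ i j (x : K.obj i) (y : K.obj j), (c.ι.app i).hom x = (c.ι.app j).hom y →
      ∃ (k : I) (a : i ⟶ k) (b : j ⟶ k), (K.map a).hom x = (K.map b).hom y) : IsColimit c :=
  haveI : ReflectsColimitsOfShape I (forget (ModuleCat.{u} R)) :=
    reflectsColimitsOfShape_of_reflectsIsomorphisms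
  isColimitOfReflects (forget (ModuleCat.{u} R)) <|
    Types.FilteredColimit.isColimitOf _ _
      (fun x => by obtain ⟨i, y, h⟩ := hsurj x; exact ⟨i, y, h.symm⟩) hinj

/-- The directed system of finitely generated submodules. -/
def fgSubmoduleFunctor (S : Type u) [AddCommGroup S] [Module R S] :
    {N : Submodule R S // N.FG} ⥤ ModuleCat.{u} R where
  obj N := ModuleCat.of R N.1
  map f := ModuleCat.ofHom (Submodule.inclusion (leOfHom f))

/-- A module as a cocone over its finitely generated submodules. -/
def fgSubmoduleCocone (S : Type u) [AddCommGroup S] [Module R S] :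
    Cocone (fgSubmoduleFunctor (R := R) S) where
  pt := ModuleCat.of R S
  ι := { app := fun N => ModuleCat.ofHom N.1.subtype }

instance fgSubmodule_isDirectedOrder (S : Type u) [AddCommGroup S] [Module R S] :
    IsDirectedOrder {N : Submodule R S // N.FG} :=
  ⟨fun N N' => ⟨⟨N.1 ⊔ N'.1, N.2.sup N'.2⟩, le_sup_left (a := N.1), le_sup_right (a := N.1)⟩⟩

instance fgSubmodule_nonempty (S : Type u) [AddCommGroup S] [Module R S] :
    Nonempty {N : Submodule R S // N.FG} := ⟨⟨⊥, Submodule.fg_bot⟩⟩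

/-- A module is the directed union of its finitely generated submodules. -/
noncomputable def fgSubmoduleCoconeIsColimit (S : Type u) [AddCommGroup S] [Module R S] :
    IsColimit (fgSubmoduleCocone (R := R) S) :=
  ModuleCat.isColimitOf _
    (fun x => ⟨⟨Submodule.span R {x}, Submodule.fg_span_singleton x⟩,
      ⟨x, Submodule.mem_span_singleton_self x⟩, rfl⟩)
    (fun i j x y h => by
      obtain ⟨k, hi, hj⟩ := exists_ge_ge i j
      exact ⟨k, homOfLE hi, homOfLE hj, Subtype.ext h⟩)

theorem IsQsCh.exists_rep {F : ModuleCat.{u} R ⥤ AddCommGrpCat.{u}} (hF : IsQsCh F)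
    {I : Type u} [Preorder I] [IsDirectedOrder I] [Nonempty I] {K : I ⥤ ModuleCat.{u} R}
    {c : Cocone K} (hc : IsColimit c) (x : F.obj c.pt) :
    ∃ (i : I) (y : F.obj (K.obj i)), (F.map (c.ι.app i)).hom y = x := by
  have := hF.preservesDirectLimits I
  exact Concrete.isColimit_exists_rep (K ⋙ F) (isColimitOfPreserves F hc) x

theorem IsQsCh.exists_of_rep_eq {F : ModuleCat.{u} R ⥤ AddCommGrpCat.{u}} (hF : IsQsCh F)
    {I : Type u} [Preorder I] [IsDirectedOrder I] [Nonempty I] {K : I ⥤ ModuleCat.{u} R}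
    {c : Cocone K} (hc : IsColimit c) {i j : I} (x : F.obj (K.obj i)) (y : F.obj (K.obj j))
    (h : (F.map (c.ι.app i)).hom x = (F.map (c.ι.app j)).hom y) :
    ∃ (k : I) (a : i ⟶ k) (b : j ⟶ k),
      (F.map (K.map a)).hom x = (F.map (K.map b)).hom y := by
  have := hF.preservesDirectLimits I
  exact Concrete.isColimit_exists_of_rep_eq (K ⋙ F) (isColimitOfPreserves F hc) x y h

theorem AddCommGrpCat.map_comp_hom_apply (F : ModuleCat.{u} R ⥤ AddCommGrpCat.{u})
    {S T U : ModuleCat.{u} R} (f : S ⟶ T) (g : T ⟶ U) (x : F.obj S) :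
    (F.map (f ≫ g)).hom x = (F.map g).hom ((F.map f).hom x) := by
  rw [F.map_comp, AddCommGrpCat.hom_comp, AddMonoidHom.comp_apply]

/-- Every element of `F(S)` comes from a finitely generated module of the form `R^n / L`. -/
theorem IsQsCh.exists_rep_quotient {F : ModuleCat.{u} R ⥤ AddCommGrpCat.{u}} (hF : IsQsCh F)
    (S : ModuleCat.{u} R) (s : F.obj S) :
    ∃ (n : ℕ) (L : Submodule R (Fin n → R)) (y : F.obj (ModuleCat.of R ((Fin n → R) ⧸ L)))
      (h : ModuleCat.of R ((Fin n → R) ⧸ L) ⟶ S), (F.map h).hom y = s := by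
  obtain ⟨N, (y : F.obj (ModuleCat.of R N.1)),
    (hy : (F.map (ModuleCat.ofHom N.1.subtype)).hom y = s)⟩ :=
      hF.exists_rep (fgSubmoduleCoconeIsColimit (R := R) S) s
  have : Module.Finite R N.1 := Module.Finite.iff_fg.2 N.2
  obtain ⟨n, f, hf⟩ := Module.Finite.exists_fin' R N.1
  let e : ModuleCat.of R ((Fin n → R) ⧸ LinearMap.ker f) ≅ ModuleCat.of R N.1 :=
    (f.quotKerEquivOfSurjective hf).toModuleIso
  refine ⟨n, LinearMap.ker f, (F.map e.inv).hom y,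
    e.hom ≫ ModuleCat.ofHom N.1.subtype, ?_⟩
  rw [← AddCommGrpCat.map_comp_hom_apply, Iso.inv_hom_id_assoc]
  exact hy

/-- A functor that preserves direct limits and for which `F(∏ S i) → ∏ F(S i)` is surjective
is generated by one element. -/
theorem IsFPFunctor.exists_generator {F : ModuleCat.{u} R ⥤ AddCommGrpCat.{u}}
    (hF : IsFPFunctor F) :
    ∃ (A : ModuleCat.{u} R) (x : F.obj A), ∀ (S : ModuleCat.{u} R) (s : F.obj S),
      ∃ h : A ⟶ S, (F.map h).hom x = s := by
  -- The quotients `Rⁿ / L` form a set in `Type u`, so one product accommodates every element of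
  -- every `F(Rⁿ / L)`. A preimage of this whole family specializes to each of them.
  let J : Type u := Σ (n : ℕ) (L : Submodule R (Fin n → R)),
    F.obj (ModuleCat.of R ((Fin n → R) ⧸ L))
  let Q : J → ModuleCat.{u} R := fun j => ModuleCat.of R ((Fin j.1 → R) ⧸ j.2.1)
  obtain ⟨x, hx⟩ := (hF.bijective J Q).2 fun j => j.2.2
  refine ⟨_, x, fun S s => ?_⟩
  obtain ⟨n, L, y, h, rfl⟩ := hF.isQsCh.exists_rep_quotient S s
  refine ⟨ModuleCat.ofHom (LinearMap.proj (⟨n, L, y⟩ : J)) ≫ h, ?_⟩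
  rw [AddCommGrpCat.map_comp_hom_apply]
  exact congrArg _ (congrFun hx ⟨n, L, y⟩)

end Colimits

/-! ### Strict Mittag-Leffler modules are SML -/

section StrictMittagLeffler

variable {R : Type u} [Ring R]

open BalancedTensor

/-- Every element of `M ⊗_R S` is fixed by the endomorphisms that fix a certain finitely
generated submodule. -/
theorem BalancedTensor.exists_fg_map_map_eq {M : Type u} [AddCommGroup M] [Module Rᵐᵒᵖ M]
    {S : Type u} [AddCommGroup S] [Module R S] (x : BalancedTensor R M S) :
    ∃ (N : {N : Submodule Rᵐᵒᵖ M // N.FG}),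
      ∀ (P : ModuleCat.{u} Rᵐᵒᵖ) (f : M →ₗ[Rᵐᵒᵖ] P) (g : P →ₗ[Rᵐᵒᵖ] M),
        g.comp (f.comp N.1.subtype) = N.1.subtype →
          BalancedTensor.map R g (LinearMap.id : S →ₗ[R] S)
            (BalancedTensor.map R f LinearMap.id x) = x := by
  obtain ⟨n, m, s, rfl⟩ := exists_eq_sumTmul R x
  refine ⟨⟨Submodule.span _ (Set.range m), Submodule.fg_span (Set.finite_range m)⟩,
    fun P f g h => ?_⟩
  rw [map_sumTmul, map_sumTmul]
  have : ∀ i, g (f (m i)) = m i := fun i =>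
    DFunLike.congr_fun h ⟨m i, Submodule.subset_span ⟨i, rfl⟩⟩
  simp [this]

theorem IsStrictMittagLeffler.eq_zero_of_map_proj_eq_zero {M : Type u} [AddCommGroup M]
    [Module Rᵐᵒᵖ M] (hM : IsStrictMittagLeffler Rᵐᵒᵖ M) {I : Type u} (S : I → Type u)
    [∀ i, AddCommGroup (S i)] [∀ i, Module R (S i)] (x : BalancedTensor R M (∀ i, S i))
    (hx : ∀ i, BalancedTensor.map R LinearMap.id (LinearMap.proj i : (∀ i, S i) →ₗ[R] S i) x = 0) :
    x = 0 := by
  obtain ⟨N, hN⟩ := exists_fg_map_map_eq x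
  obtain ⟨P, f, g, hP, hfg⟩ := hM N.1 N.2
  have h0 := BalancedTensor.eq_zero_of_map_proj_eq_zero R P S
    (BalancedTensor.map R f LinearMap.id x) fun i => by
      rw [← AddMonoidHom.comp_apply, ← map_comp, LinearMap.id_comp, LinearMap.comp_id,
        ← LinearMap.comp_id f, ← LinearMap.id_comp (LinearMap.proj i), map_comp,
        AddMonoidHom.comp_apply, hx, map_zero]
  rw [← hN P f g hfg, h0, map_zero]

theorem IsStrictMittagLeffler.isMLFunctor (M : ModuleCat.{u} Rᵐᵒᵖ)
    (hM : IsStrictMittagLeffler Rᵐᵒᵖ M) : IsMLFunctor (quasiCoherent (R := R) M) where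
  isQsCh := isQsCh_quasiCoherent M
  injective _ S := (injective_iff_map_eq_zero _).2 fun x hx =>
    hM.eq_zero_of_map_proj_eq_zero (fun i => S i) x fun i => congrFun hx i

theorem IsMLFunctor.eq_of_map_proj_eq {M : ModuleCat.{u} Rᵐᵒᵖ}
    (hM : IsMLFunctor (quasiCoherent (R := R) M)) {I : Type u} (S : I → Type u)
    [∀ i, AddCommGroup (S i)] [∀ i, Module R (S i)] (x y : BalancedTensor R M (∀ i, S i))
    (hxy : ∀ i, BalancedTensor.map R LinearMap.id (LinearMap.proj i : (∀ i, S i) →ₗ[R] S i) x =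
      BalancedTensor.map R LinearMap.id (LinearMap.proj i : (∀ i, S i) →ₗ[R] S i) y) :
    x = y :=
  hM.injective I (fun i => ModuleCat.of R (S i)) (funext hxy)

theorem AddCommGrpCat.app_map_hom_apply {F G : ModuleCat.{u} R ⥤ AddCommGrpCat.{u}} (w : F ⟶ G)
    {S T : ModuleCat.{u} R} (h : S ⟶ T) (x : F.obj S) :
    (w.app T).hom ((F.map h).hom x) = (G.map h).hom ((w.app S).hom x) := by
  have := congrArg (fun f => f.hom x) (w.naturality h)
  simpa only [AddCommGrpCat.hom_comp, AddMonoidHom.comp_apply] using this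

/-- Epimorphisms of functors are tested pointwise, and in abelian groups they are the surjections;
here surjectivity is an extension property. -/
theorem epi_dualMap_iff {F G : ModuleCat.{u} R ⥤ AddCommGrpCat.{u}} (i : F ⟶ G) :
    Epi (dualMap i) ↔ ∀ (N : ModuleCat.{u} Rᵐᵒᵖ) (w : F ⟶ quasiCoherent N),
      ∃ W : G ⟶ quasiCoherent N, i ≫ W = w := by
  rw [NatTrans.epi_iff_epi_app]
  simp_rw [AddCommGrpCat.epi_iff_surjective]
  rfl

theorem IsStrictMittagLeffler.isSMLFunctor (M : ModuleCat.{u} Rᵐᵒᵖ)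
    (hM : IsStrictMittagLeffler Rᵐᵒᵖ M) : IsSMLFunctor (quasiCoherent (R := R) M) where
  isML := hM.isMLFunctor
  epi_dual F i hF hi := by
    rw [epi_dualMap_iff]
    intro N w
    have hinj : ∀ S, Function.Injective (i.app S).hom := fun S =>
      (AddCommGrpCat.mono_iff_injective _).1 ((NatTrans.mono_iff_mono_app i).1 hi S)
    obtain ⟨A, x, hx⟩ := hF.exists_generator
    let b : BalancedTensor R M A := (i.app A).hom x
    let c : BalancedTensor R N A := (w.app A).hom x
    obtain ⟨K, hK⟩ := exists_fg_map_map_eq b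
    obtain ⟨P, f, g, hP, hfg⟩ := hM K.1 K.2
    have hb := hK P f g hfg
    -- If `h` kills `f(b)`, it kills `b = g(f(b))`, hence `x` because `i` is injective, hence `c =
    -- w(x)`.
    obtain ⟨φ, hφ⟩ := exists_map_eq_of_forall_map_eq_zero R P N A
      (BalancedTensor.map R f LinearMap.id b) c fun S _ _ h h0 => by
        have h1 : (i.app (ModuleCat.of R S)).hom ((F.map (ModuleCat.ofHom h)).hom x) = 0 := by
          rw [AddCommGrpCat.app_map_hom_apply]
          change BalancedTensor.map R LinearMap.id h b = 0
          rw [← hb, ← AddMonoidHom.comp_apply (BalancedTensor.map R LinearMap.id h), ← map_comp,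
            LinearMap.id_comp, LinearMap.comp_id, ← LinearMap.comp_id g, ← LinearMap.id_comp h,
            map_comp, AddMonoidHom.comp_apply, h0, map_zero]
        have h2 : (F.map (ModuleCat.ofHom h)).hom x = 0 := hinj _ (h1.trans (map_zero _).symm)
        have h3 := AddCommGrpCat.app_map_hom_apply w (ModuleCat.ofHom h) x
        rw [h2, map_zero] at h3
        exact h3.symm
    refine ⟨(quasiCoherentFunctor R).map (ModuleCat.ofHom (φ ∘ₗ f)), ?_⟩
    have hA : BalancedTensor.map R (φ ∘ₗ f) LinearMap.id b = c := by
      rw [← hφ, ← AddMonoidHom.comp_apply, ← map_comp, LinearMap.comp_id]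
    ext S s
    obtain ⟨h, rfl⟩ := hx S s
    rw [AddCommGrpCat.app_map_hom_apply, AddCommGrpCat.app_map_hom_apply]
    exact congrArg _ hA

/-! ### Finitely generated subfunctors of `𝓜` and their relations -/

/-- The image `S ↦ im (S^n → M ⊗_R S)` of the map `𝓡^n → 𝓜` given by `m`. -/
noncomputable def spanFunctor {M : ModuleCat.{u} Rᵐᵒᵖ} {n : ℕ} (m : Fin n → M) :
    ModuleCat.{u} R ⥤ AddCommGrpCat.{u} where
  obj S := AddCommGrpCat.of (sumTmul R m S).range
  map {S T} h := AddCommGrpCat.ofHom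
    (((BalancedTensor.map R LinearMap.id h.hom).comp (sumTmul R m S).range.subtype).codRestrict
      (sumTmul R m T).range (by
        rintro ⟨_, s, rfl⟩
        exact ⟨fun i => h.hom (s i), (map_sumTmul R LinearMap.id h.hom m s).symm⟩))
  map_id S := by
    refine AddCommGrpCat.hom_ext (AddMonoidHom.ext fun x => Subtype.ext ?_)
    exact DFunLike.congr_fun (BalancedTensor.map_id R) x.1
  map_comp h h' := by
    refine AddCommGrpCat.hom_ext (AddMonoidHom.ext fun x => Subtype.ext ?_)
    exact DFunLike.congr_fun
      (BalancedTensor.map_comp R LinearMap.id LinearMap.id h.hom h'.hom) x.1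

variable {M : ModuleCat.{u} Rᵐᵒᵖ} {n : ℕ} (m : Fin n → M)

/-- The inclusion into `𝓜`. -/
noncomputable def spanFunctorι : spanFunctor (R := R) m ⟶ quasiCoherent M where
  app S := AddCommGrpCat.ofHom (sumTmul R m S).range.subtype

instance : Mono (spanFunctorι (R := R) m) := by
  rw [NatTrans.mono_iff_mono_app]
  intro S
  rw [AddCommGrpCat.mono_iff_injective]
  exact Subtype.val_injective

theorem isQsCh_spanFunctor : IsQsCh (spanFunctor (R := R) m) where
  additive :=
    { map_add := fun {S T f g} => by
        ext x
        exact Subtype.ext (DFunLike.congr_fun (map_add_right R LinearMap.id f.hom g.hom) x.1) }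
  preservesDirectLimits I _ _ _ :=
    { preservesColimit := fun {K} =>
      { preserves := fun {c} hc => ⟨AddCommGrpCat.isColimitOf _ (by
            rintro ⟨_, s, rfl⟩
            have hs : ∀ i, ∃ (a : I) (y : K.obj a), (c.ι.app a).hom y = s i := fun i =>
              Concrete.isColimit_exists_rep K hc (s i)
            choose a y hy using hs
            -- There are finitely many coefficients, so all of them lift to one common stage.
            obtain ⟨k, hk⟩ := (Set.finite_range a).bddAbove
            have hak : ∀ i, a i ≤ k := fun i => hk ⟨i, rfl⟩
            refine ⟨k, ⟨sumTmul R m (K.obj k)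
              (fun i => (K.map (homOfLE (hak i))).hom (y i)), ⟨_, rfl⟩⟩, Subtype.ext ?_⟩
            refine (map_sumTmul R LinearMap.id (c.ι.app k).hom m _).trans ?_
            refine congrArg _ (funext fun i => ?_)
            rw [← hy i, ← c.w (homOfLE (hak i))]
            rfl) (by
            intro i j x y h
            obtain ⟨k, a, b, hab⟩ := (isQsCh_quasiCoherent M).exists_of_rep_eq hc x.1 y.1
              (congrArg Subtype.val h)
            exact ⟨k, a, b, Subtype.ext hab⟩)⟩ } }

/-- Injectivity is inherited from `𝓜`. Surjectivity holds because every element has an expression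
with the same `n` generators, so coefficients can be chosen factor by factor. -/
theorem isFPFunctor_spanFunctor (hM : IsMLFunctor (quasiCoherent (R := R) M)) :
    IsFPFunctor (spanFunctor (R := R) m) where
  isQsCh := isQsCh_spanFunctor m
  bijective I S := by
    refine ⟨fun x y hxy => ?_, fun y => ?_⟩
    · refine Subtype.ext (hM.eq_of_map_proj_eq (fun i => S i) x.1 y.1 fun i => ?_)
      exact congrArg Subtype.val (congrFun hxy i)
    · have : ∀ i, ∃ s : Fin n → S i, sumTmul R m (S i) s = (y i).1 := fun i => (y i).2
      choose s hs using this
      refine ⟨⟨sumTmul R m (∀ i, S i) (fun j i => s i j), ⟨_, rfl⟩⟩, funext fun i => ?_⟩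
      refine Subtype.ext (Eq.trans ?_ (hs i))
      exact map_sumTmul R LinearMap.id (LinearMap.proj i : (∀ i, S i) →ₗ[R] S i) m
        (fun j i => s i j)

theorem IsMLFunctor.sumTmul_pi_eq_zero (hM : IsMLFunctor (quasiCoherent (R := R) M))
    {I : Type u} (S : I → Type u) [∀ i, AddCommGroup (S i)] [∀ i, Module R (S i)]
    (t : ∀ i, Fin n → S i) (ht : ∀ i, sumTmul R m (S i) (t i) = 0) :
    sumTmul R m (∀ i, S i) (fun j i => t i j) = 0 := by
  refine hM.eq_of_map_proj_eq S _ 0 fun i => ?_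
  rw [map_zero, map_sumTmul]
  exact ht i

/-- A relation among `m` with coefficients in `S` comes from some `R^q / L`. -/
theorem exists_quotient_sumTmul_eq_zero (S : Type u) [AddCommGroup S] [Module R S] (s : Fin n → S)
    (hs : sumTmul R m S s = 0) :
    ∃ (q : ℕ) (L : Submodule R (Fin q → R)) (t : Fin n → (Fin q → R) ⧸ L)
      (h : ((Fin q → R) ⧸ L) →ₗ[R] S),
      sumTmul R m ((Fin q → R) ⧸ L) t = 0 ∧ ∀ i, h (t i) = s i := by
  let N₀ : {N : Submodule R S // N.FG} :=
    ⟨Submodule.span R (Set.range s), Submodule.fg_span (Set.finite_range s)⟩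
  let s₀ : Fin n → N₀.1 := fun i => ⟨s i, Submodule.subset_span ⟨i, rfl⟩⟩
  -- The relation may fail over `N₀`, but it holds over some larger finitely generated submodule,
  -- since `𝓜` preserves direct limits.
  obtain ⟨N, a, b, hab⟩ := (isQsCh_quasiCoherent M).exists_of_rep_eq
    (fgSubmoduleCoconeIsColimit (R := R) S) (i := N₀) (j := N₀) (sumTmul R m N₀.1 s₀) 0 (by
      rw [map_zero]
      exact (map_sumTmul R LinearMap.id N₀.1.subtype m s₀).trans hs)
  rw [map_zero] at hab
  let s₁ : Fin n → N.1 := fun i => Submodule.inclusion (leOfHom a) (s₀ i)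
  have hs₁ : sumTmul R m N.1 s₁ = 0 :=
    (map_sumTmul R LinearMap.id (Submodule.inclusion (leOfHom a)) m s₀).symm.trans hab
  have : Module.Finite R N.1 := Module.Finite.iff_fg.2 N.2
  obtain ⟨q, f, hf⟩ := Module.Finite.exists_fin' R N.1
  let e := f.quotKerEquivOfSurjective hf
  refine ⟨q, LinearMap.ker f, fun i => e.symm (s₁ i), N.1.subtype ∘ₗ e.toLinearMap, ?_,
    fun i => ?_⟩
  · have := map_sumTmul R LinearMap.id e.symm.toLinearMap m s₁
    rw [hs₁, map_zero] at this
    exact this.symm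
  · exact congrArg N.1.subtype (e.apply_symm_apply (s₁ i))

/-- If `𝓜` is an ML module, the relations among `m` that come from a set of relations are
generated by a single one. -/
theorem IsMLFunctor.exists_generator_of_family (hM : IsMLFunctor (quasiCoherent (R := R) M))
    {J : Type u} (Q : J → ModuleCat.{u} R) (t : ∀ j, Fin n → Q j)
    (ht : ∀ j, sumTmul R m (Q j) (t j) = 0)
    (hQ : ∀ (S : ModuleCat.{u} R) (s : Fin n → S), sumTmul R m S s = 0 →
      ∃ (j : J) (h : Q j →ₗ[R] S), ∀ i, h (t j i) = s i) :
    ∃ (A : ModuleCat.{u} R) (k : Fin n → A), sumTmul R m A k = 0 ∧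
      ∀ (S : ModuleCat.{u} R) (s : Fin n → S), sumTmul R m S s = 0 →
        ∃ h : A →ₗ[R] S, ∀ i, h (k i) = s i := by
  refine ⟨ModuleCat.of R (∀ j, Q j), fun i j => t j i,
    hM.sumTmul_pi_eq_zero m (fun j => Q j) t ht, fun S s hs => ?_⟩
  obtain ⟨j, h, hj⟩ := hQ S s hs
  exact ⟨h ∘ₗ (LinearMap.proj j : (∀ j, Q j) →ₗ[R] Q j), hj⟩

/-- The relations among `m` with coefficients in finitely generated left modules `R^q / L`. -/
structure FGRelation {M : ModuleCat.{u} Rᵐᵒᵖ} {n : ℕ} (m : Fin n → M) : Type u where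
  /-- The number of generators. -/
  rank : ℕ
  /-- The relations between the generators. -/
  relations : Submodule R (Fin rank → R)
  /-- The coefficients. -/
  coeff : Fin n → (Fin rank → R) ⧸ relations
  sumTmul_eq_zero : sumTmul R m ((Fin rank → R) ⧸ relations) coeff = 0

/-- If `𝓜` is an ML module, the relations among `m` are generated by a single one. -/
theorem IsMLFunctor.exists_generator_relations (hM : IsMLFunctor (quasiCoherent (R := R) M)) :
    ∃ (A : ModuleCat.{u} R) (k : Fin n → A), sumTmul R m A k = 0 ∧
      ∀ (S : ModuleCat.{u} R) (s : Fin n → S), sumTmul R m S s = 0 →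
        ∃ h : A →ₗ[R] S, ∀ i, h (k i) = s i := by
  refine hM.exists_generator_of_family m
    (fun j : FGRelation m => ModuleCat.of R ((Fin j.rank → R) ⧸ j.relations))
    FGRelation.coeff FGRelation.sumTmul_eq_zero fun S s hs => ?_
  obtain ⟨q, L, t, h, ht, hts⟩ := exists_quotient_sumTmul_eq_zero m S s hs
  exact ⟨⟨q, L, t, ht⟩, h, hts⟩

/-! ### SML modules are strict Mittag-Leffler -/

theorem IsSMLFunctor.isStrictMittagLeffler (hM : IsSMLFunctor (quasiCoherent (R := R) M)) :
    IsStrictMittagLeffler Rᵐᵒᵖ M := by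
  intro N hN
  obtain ⟨n, m, hm⟩ := Submodule.fg_iff_exists_fin_generating_family.1 hN
  obtain ⟨A, k, hk, hgen⟩ := hM.isML.exists_generator_relations m
  obtain ⟨P, p, g, hP, hgp, hp⟩ := exists_finitePresentation_of_sumTmul_eq_zero R m k hk
  -- Any relation among the `m i` is an image of the generating one `k`, which the `p i` satisfy; so
  -- `m i ↦ p i` is well defined on the image functor.
  have hker : ∀ S : ModuleCat.{u} R,
      (sumTmul R m S).rangeRestrict.ker ≤ (sumTmul R p S).ker := fun S s hs => by
    obtain ⟨h, hh⟩ := hgen S s (congrArg Subtype.val hs)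
    have := map_sumTmul R LinearMap.id h p k
    rw [hp, map_zero] at this
    simpa [hh] using this.symm
  let w₀ : ∀ S : ModuleCat.{u} R, (sumTmul R m S).range →+ BalancedTensor R P S := fun S =>
    (sumTmul R m S).rangeRestrict.liftOfSurjective (AddMonoidHom.rangeRestrict_surjective _)
      ⟨sumTmul R p S, hker S⟩
  have hw₀ : ∀ S s, w₀ S ((sumTmul R m S).rangeRestrict s) = sumTmul R p S s := fun S s =>
    AddMonoidHom.liftOfRightInverse_comp_apply _ _ _ _ _
  let w : spanFunctor (R := R) m ⟶ quasiCoherent P :=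
    { app := fun S => AddCommGrpCat.ofHom (w₀ S)
      naturality := fun S T h => by
        ext x
        obtain ⟨s, rfl⟩ := AddMonoidHom.rangeRestrict_surjective _ x
        have e : (BalancedTensor.map R LinearMap.id h.hom) (w₀ S ((sumTmul R m S).rangeRestrict s))
            = w₀ T ((sumTmul R m T).rangeRestrict (fun i => h.hom (s i))) := by
          rw [hw₀, hw₀, map_sumTmul]; rfl
        refine Eq.trans ?_ e.symm
        exact congrArg (w₀ T) (Subtype.ext (map_sumTmul R LinearMap.id h.hom m s)) }
  obtain ⟨W, hW⟩ := (epi_dualMap_iff _).1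
    (hM.epi_dual _ (spanFunctorι m) (isFPFunctor_spanFunctor m hM.isML) inferInstance) P w
  let W₁ : BalancedTensor R M R →+ BalancedTensor R P R := (W.app (ModuleCat.of R R)).hom
  -- The left-linear map `toSpanSingleton R R a` is right multiplication by `a`; naturality for it
  -- is what makes `f` linear over `Rᵐᵒᵖ`.
  have hWnat : ∀ (a : R) (x : BalancedTensor R M R),
      W₁ (BalancedTensor.map R LinearMap.id (LinearMap.toSpanSingleton R R a) x) =
        BalancedTensor.map R LinearMap.id (LinearMap.toSpanSingleton R R a) (W₁ x) :=
    fun a x => AddCommGrpCat.app_map_hom_apply W (S := ModuleCat.of R R) (T := ModuleCat.of R R)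
      (ModuleCat.ofHom (LinearMap.toSpanSingleton R R a)) x
  let act : BalancedTensor R P R →+ P :=
    lift (AddMonoidHom.mk' (fun m => AddMonoidHom.mk' (fun a : R => MulOpposite.op a • m)
      (fun a b => by simp [add_smul])) (fun m m' => by ext; simp))
      (fun m a b => by simp [mul_smul])
  have hact : ∀ m a, act (tmul R m a) = MulOpposite.op a • m := fun _ _ => rfl
  have hact' : ∀ (a : R) x, act (BalancedTensor.map R LinearMap.id
      (LinearMap.toSpanSingleton R R a) x) = MulOpposite.op a • act x := fun a => by
    refine DFunLike.congr_fun (f := act.comp (BalancedTensor.map R LinearMap.id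
      (LinearMap.toSpanSingleton R R a)))
      (g := (DistribSMul.toAddMonoidHom P (MulOpposite.op a)).comp act) (addHom_ext R fun y b => ?_)
    simp [hact, mul_smul]
  let f : M →ₗ[Rᵐᵒᵖ] P :=
    { toFun := fun y => act (W₁ (tmul R y 1))
      map_add' := fun y z => by rw [add_tmul, map_add, map_add]
      map_smul' := fun a y => by
        have := hWnat a.unop (tmul R y 1)
        rw [map_tmul] at this
        rw [LinearMap.id_apply, LinearMap.toSpanSingleton_apply, smul_eq_mul, one_mul] at this
        rw [← MulOpposite.op_unop a, tmul_balanced, smul_eq_mul, mul_one, this, hact']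
        rfl }
  have hf : ∀ i, f (m i) = p i := fun i => by
    have e : sumTmul R m R (Pi.single i 1) = tmul R (m i) 1 := by
      rw [sumTmul_apply, Finset.sum_eq_single i _ (by simp)]
      · simp
      · intro j _ hj
        rw [Pi.single_eq_of_ne hj, tmul_zero]
    have e' : sumTmul R p R (Pi.single i 1) = tmul R (p i) 1 := by
      rw [sumTmul_apply, Finset.sum_eq_single i _ (by simp)]
      · simp
      · intro j _ hj
        rw [Pi.single_eq_of_ne hj, tmul_zero]
    have h1 : W₁ (sumTmul R m R (Pi.single i 1)) =
        w₀ (ModuleCat.of R R) ((sumTmul R m R).rangeRestrict (Pi.single i 1)) :=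
      congrArg (fun v => (v.app (ModuleCat.of R R)).hom
        ((sumTmul R m R).rangeRestrict (Pi.single i 1))) hW
    rw [e] at h1
    have h2 := hw₀ (ModuleCat.of R R) (Pi.single i 1)
    change act (W₁ (tmul R (m i) 1)) = p i
    rw [h1]
    refine (congrArg act (h2.trans e')).trans ?_
    simp [hact]
  refine ⟨P, f, g, hP, ?_⟩
  ext ⟨y, hy⟩
  change g (f y) = y
  rw [← hm] at hy
  have : Set.EqOn (g ∘ₗ f) LinearMap.id (Submodule.span Rᵐᵒᵖ (Set.range m) : Set M) :=
    LinearMap.eqOn_span (by rintro _ ⟨i, rfl⟩; simp [hf, hgp])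
  exact this hy

end StrictMittagLeffler

/-! ### The pure embedding -/

/-- A strict Mittag-Leffler module is a pure submodule of a product of finitely presented
modules. -/
theorem IsStrictMittagLeffler.exists_pure_embedding (R : Type u) [Ring R] (M : Type u)
    [AddCommGroup M] [Module Rᵐᵒᵖ M] (hM : IsStrictMittagLeffler Rᵐᵒᵖ M) :
    ∃ (J : Type u) (P : J → ModuleCat.{u} Rᵐᵒᵖ) (f : M →ₗ[Rᵐᵒᵖ] (∀ j, P j)),
      (∀ j, Module.FinitePresentation Rᵐᵒᵖ (P j)) ∧ Function.Injective f ∧ IsPureMono R f := by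
  choose P f g hP hfg using hM
  refine ⟨{N : Submodule Rᵐᵒᵖ M // N.FG}, fun N => P N.1 N.2,
    LinearMap.pi fun N => f N.1 N.2, fun N => hP N.1 N.2, ?_, fun S => ?_⟩
  · refine (injective_iff_map_eq_zero _).2 fun x hx => ?_
    have hN := Submodule.fg_span_singleton (R := Rᵐᵒᵖ) x
    have h0 : f _ hN x = 0 := congrFun hx ⟨_, hN⟩
    have := DFunLike.congr_fun (hfg _ hN) ⟨x, Submodule.mem_span_singleton_self x⟩
    simpa [h0] using this.symm
  · refine (injective_iff_map_eq_zero _).2 fun x hx => ?_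
    obtain ⟨N, hN⟩ := BalancedTensor.exists_fg_map_map_eq x
    -- `x` is recovered by `g` from its image under the single component `f N`, which vanishes.
    rw [← hN _ _ _ (hfg N.1 N.2)]
    have := congrArg (BalancedTensor.map R (LinearMap.proj N :
      (∀ N : {N : Submodule Rᵐᵒᵖ M // N.FG}, P N.1 N.2) →ₗ[Rᵐᵒᵖ] P N.1 N.2) LinearMap.id) hx
    rw [← AddMonoidHom.comp_apply, ← BalancedTensor.map_comp, map_zero] at this
    exact (congrArg _ this).trans (map_zero _)

theorem mainTheorem4 (R : Type u) [Ring R] (M : Type u) [AddCommGroup M] [Module Rᵐᵒᵖ M] :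
    (IsStrictMittagLeffler Rᵐᵒᵖ M ↔
      IsSMLFunctor (R := R) (quasiCoherent (ModuleCat.of Rᵐᵒᵖ M))) ∧
    (IsStrictMittagLeffler Rᵐᵒᵖ M →
      ∃ (J : Type u) (P : J → ModuleCat.{u} Rᵐᵒᵖ) (f : M →ₗ[Rᵐᵒᵖ] (∀ j, P j)),
        (∀ j, Module.FinitePresentation Rᵐᵒᵖ (P j)) ∧ Function.Injective f ∧
          IsPureMono R f) :=
  ⟨⟨fun h => IsStrictMittagLeffler.isSMLFunctor (ModuleCat.of Rᵐᵒᵖ M) h,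
    fun h => h.isStrictMittagLeffler⟩, IsStrictMittagLeffler.exists_pure_embedding R M⟩
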